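/- Let $m,n\ge 0$ be integers. Let $\mathcal H_m$ be the Hilbert space of $m$ bosonic modes, with orthonormal Fock basis $\{|\boldsymbol k\rangle\}_{\boldsymbol k=(k_1,\dots,k_m)\in\mathbb N^m}$, and write $|\boldsymbol k|=\sum_{i=1}^m k_i$. A state is a unit vector of $\mathcal H_m$. For $\boldsymbol\alpha\in\mathbb C^m$, the $m$-mode coherent state is $|\boldsymbol\alpha\rangle=|\alpha_1\rangle\otimes\cdots\otimes|\alpha_m\rangle$ with $|\alpha\rangle=e^{-|\alpha|^2/2}\sum_{k\ge 0}\frac{\alpha^k}{\sqrt{k!}}|k\rangle$. The approximate coherent state rank $\kappa(\boldsymbol\psi)\in\mathbb N\cup\{\infty\}$ of a state $|\boldsymbol\psi\rangle$ is the smallest $r$ such that for every $\varepsilon>0$ there is a state of the form $|\boldsymbol\phi_\varepsilon\rangle=\sum_{j=1}^r c_j|\boldsymbol\alpha_j\rangle$, with $c_j\in\mathbb C$ and $|\boldsymbol\alpha_j\rangle$ coherent states, such that $|\langle\boldsymbol\psi|\boldsymbol\phi_\varepsilon\rangle|^2\ge 1-\varepsilon$ (and $\kappa(\boldsymbol\psi)=\infty$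 if there is no such $r$). Theorem. Let $|\boldsymbol\psi\rangle=\sum_{|\boldsymbol k|\le n}c_{\boldsymbol k}|\boldsymbol k\rangle$ be a state that is a superposition of $m$-mode Fock states with total number of bosons at most $n$, and suppose that $c_{\boldsymbol k}\neq 0$ for at least one $\boldsymbol k$ with $|\boldsymbol k|=n$. Then $\kappa(\boldsymbol\psi)\ge n+1$. -/

import Mathlib

noncomputable section

/-- The Hilbert space of `m` bosonic modes, in its Fock basis: square-summable families of complex
amplitudes indexed by the occupation numbers `(n₁, …, nₘ) ∈ ℕᵐ`. -/
abbrev FockSpace (m : ℕ) : Type := lp (fun _ : Fin m → ℕ => ℂ) 2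

/-- The `m`-mode Fock state `|n₁, …, nₘ⟩`. -/
def fockState {m : ℕ} (k : Fin m → ℕ) : FockSpace m := lp.single 2 k (1 : ℂ)

/-- The Fock amplitude `⟨k|α⟩ = exp (-|α|² / 2) * α ^ k / √(k!)` of the single-mode coherent state
of amplitude `α`. -/
def coherentAmplitude (α : ℂ) (k : ℕ) : ℂ :=
  (Real.exp (-(‖α‖ ^ 2) / 2) : ℂ) * (α ^ k / (Real.sqrt (k.factorial : ℝ) : ℂ))

theorem norm_coherentAmplitude_sq (α : ℂ) (k : ℕ) :
    ‖coherentAmplitude α k‖ ^ 2 =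
      Real.exp (-(‖α‖ ^ 2)) * ((‖α‖ ^ 2) ^ k / (k.factorial : ℝ)) := by
  have h : Real.exp (-(‖α‖ ^ 2) / 2) ^ 2 = Real.exp (-(‖α‖ ^ 2)) := by
    rw [← Real.exp_nat_mul]
    congr 1
    push_cast
    ring
  have hs : Real.sqrt (k.factorial : ℝ) ^ 2 = (k.factorial : ℝ) := Real.sq_sqrt (by positivity)
  rw [coherentAmplitude, norm_mul, norm_div, norm_pow, Complex.norm_real, Complex.norm_real,
    Real.norm_of_nonneg (Real.exp_pos _).le, Real.norm_of_nonneg (Real.sqrt_nonneg _), mul_pow,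
    div_pow, h, hs]
  ring

theorem hasSum_norm_coherentAmplitude_sq (α : ℂ) :
    HasSum (fun k : ℕ => ‖coherentAmplitude α k‖ ^ 2) 1 := by
  simp only [norm_coherentAmplitude_sq]
  have h := (NormedSpace.expSeries_div_hasSum_exp (𝔸 := ℝ) (‖α‖ ^ 2)).mul_left
    (Real.exp (-(‖α‖ ^ 2)))
  rwa [← Real.exp_eq_exp_ℝ, ← Real.exp_add, neg_add_cancel, Real.exp_zero] at h

/-- The amplitudes of a tensor product of coherent states are square-summable. -/
theorem memℓp_coherentAmplitude {m : ℕ} (α : Fin m → ℂ) :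
    Memℓp (fun k : Fin m → ℕ => ∏ i, coherentAmplitude (α i) (k i)) 2 := by
  rw [memℓp_gen_iff (by norm_num)]
  have hr : (2 : ENNReal).toReal = ((2 : ℕ) : ℝ) := by norm_num
  simp only [hr, Real.rpow_natCast, norm_prod, ← Finset.prod_pow]
  refine summable_of_sum_le (c := 1) (fun k => by positivity) fun s => ?_
  calc ∑ k ∈ s, ∏ i, ‖coherentAmplitude (α i) (k i)‖ ^ 2
      ≤ ∑ k ∈ Fintype.piFinset (fun i => s.image fun k => k i),
          ∏ i, ‖coherentAmplitude (α i) (k i)‖ ^ 2 := by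
        refine Finset.sum_le_sum_of_subset_of_nonneg (fun k hk => ?_) fun k _ _ => by positivity
        rw [Fintype.mem_piFinset]
        exact fun i => Finset.mem_image_of_mem _ hk
    _ = ∏ i, ∑ j ∈ s.image (fun k => k i), ‖coherentAmplitude (α i) j‖ ^ 2 :=
        (Finset.prod_univ_sum (fun i => s.image fun k => k i)
          fun i j => ‖coherentAmplitude (α i) j‖ ^ 2).symm
    _ ≤ 1 := by
        refine Finset.prod_le_one (fun i _ => by positivity) fun i _ => ?_
        have h := hasSum_norm_coherentAmplitude_sq (α i)
        rw [← h.tsum_eq]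
        exact h.summable.sum_le_tsum _ fun j _ => sq_nonneg _

/-- The `m`-mode coherent state `|α₁⟩ ⊗ ⋯ ⊗ |αₘ⟩`. -/
def coherentState {m : ℕ} (α : Fin m → ℂ) : FockSpace m :=
  ⟨fun k => ∏ i, coherentAmplitude (α i) (k i), memℓp_coherentAmplitude α⟩

/-- The fidelity `|⟨ψ|φ⟩|²` of two pure states (unit vectors). -/
def fidelity {m : ℕ} (ψ φ : FockSpace m) : ℝ := ‖inner ℂ ψ φ‖ ^ 2

/-- `ψ` can be approximated, to arbitrarily high fidelity, by states (unit vectors) that are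
superpositions of `r` coherent states. -/
def IsApproxByCoherent {m : ℕ} (ψ : FockSpace m) (r : ℕ) : Prop :=
  ∀ ε : ℝ, 0 < ε → ∃ (c : Fin r → ℂ) (α : Fin r → Fin m → ℂ) (φ : FockSpace m),
    φ = ∑ j, c j • coherentState (α j) ∧ ‖φ‖ = 1 ∧ 1 - ε ≤ fidelity ψ φ

/-- The approximate coherent state rank of a state (unit vector) `ψ`: the smallest `r` for which
`ψ` is approximated by superpositions of `r` coherent states, and `⊤` if there is no such `r`. -/
def approxCoherentStateRank {m : ℕ} (ψ : FockSpace m) : ℕ∞ :=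
  ⨅ (r : ℕ) (_ : IsApproxByCoherent ψ r), (r : ℕ∞)

/-- The finite set of all occupation numbers of `m` modes with at most `n` bosons in total. -/
def occupationsLE (m n : ℕ) : Finset (Fin m → ℕ) :=
  {k ∈ Fintype.piFinset fun _ : Fin m => Finset.range (n + 1) | ∑ i, k i ≤ n}

theorem mem_occupationsLE {m n : ℕ} (k : Fin m → ℕ) : k ∈ occupationsLE m n ↔ ∑ i, k i ≤ n := by
  simp only [occupationsLE, Finset.mem_filter, Fintype.mem_piFinset, Finset.mem_range,
    and_iff_right_iff_imp]
  intro h i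
  have := Finset.single_le_sum (f := k) (fun _ _ => Nat.zero_le _) (Finset.mem_univ i)
  omega

end

/-!
The rescaled amplitudes `√(k!) ⟨k|ψ⟩` of a coherent state `|α⟩` are proportional to the monomials
`α ^ k`, which are multiplicative in `k`. For a superposition of `r` coherent states, every matrix
formed by the rescaled amplitudes at `a i + b j` therefore factors through `ℂ ^ r`, so its minors of
size `r + 1` vanish. Minors are continuous, so they vanish on limits of such superpositions too.
If `ψ` has degree `n` and `⟨k|ψ⟩ ≠ 0` with `|k| = n`, then along `a 0, …, a n ≤ k` with `|a i| = i`
and `b j = k - a j` this matrix has size `n + 1` and is triangular with nonzero diagonal, because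
`|a i + b j| = n + i - j`. Hence `r ≥ n + 1`.
-/

section Hankel

variable {M R σ ι κ : Type*}

/-- The generalized Hankel matrix with entries `f (a i + b j)`, for a function `f` on an additive
semigroup; `a = b = id` on an initial segment of `ℕ` gives the usual Hankel matrices. Its rank
bounds from below the number of exponential functions whose linear combination is `f`. -/
def hankelMatrix [Add M] (f : M → R) (a b : ι → M) : Matrix ι ι R :=
  Matrix.of fun i j => f (a i + b j)

theorem det_mul_eq_zero_of_card_lt [CommRing R] [IsDomain R] [Fintype ι] [DecidableEq ι]
    [Fintype κ] (h : Fintype.card κ < Fintype.card ι) (A : Matrix ι κ R) (B : Matrix κ ι R) :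
    (A * B).det = 0 := by
  by_contra hdet
  have hrank : (A * B).rank ≤ Fintype.card κ :=
    (Matrix.rank_mul_le_left A B).trans A.rank_le_card_width
  rw [Matrix.rank_of_det_ne_zero hdet] at hrank
  exact hrank.not_gt h

theorem det_hankelMatrix_sum_eq_zero [Add M] [CommRing R] [IsDomain R] [Fintype ι]
    [DecidableEq ι] [Fintype κ] (h : Fintype.card κ < Fintype.card ι) (c : κ → R) {χ : κ → M → R}
    (hχ : ∀ j x y, χ j (x + y) = χ j x * χ j y) (a b : ι → M) :
    (hankelMatrix (fun x => ∑ j, c j * χ j x) a b).det = 0 := by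
  have hfactor : hankelMatrix (fun x => ∑ j, c j * χ j x) a b =
      Matrix.of (fun i j => c j * χ j (a i)) * Matrix.of (fun j i => χ j (b i)) := by
    ext i i'
    simp only [hankelMatrix, Matrix.of_apply, Matrix.mul_apply, hχ, mul_assoc]
  rw [hfactor, det_mul_eq_zero_of_card_lt h]

theorem exists_le_sum_eq [Fintype σ] (k : σ → ℕ) {d : ℕ} (hd : d ≤ ∑ s, k s) :
    ∃ a ≤ k, ∑ s, a s = d := by
  obtain ⟨a, hak, ha⟩ := (Finsupp.equivFunOnFinite.symm k).exists_le_degree_eq d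
    (by simpa [Finsupp.degree_eq_sum] using hd)
  exact ⟨a, fun s => by simpa using hak s, by rw [← ha, Finsupp.degree_eq_sum]⟩

theorem exists_det_hankelMatrix_eq_pow [Fintype σ] [CommRing R] {f : (σ → ℕ) → R} {k : σ → ℕ}
    (hf : ∀ l, ∑ s, k s < ∑ s, l s → f l = 0) :
    ∃ a b : Fin (∑ s, k s + 1) → σ → ℕ,
      (hankelMatrix f a b).det = f k ^ (∑ s, k s + 1) := by
  choose a hak ha using fun i : Fin (∑ s, k s + 1) => exists_le_sum_eq k (Nat.lt_succ_iff.1 i.2)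
  have hdeg (i j) : ∑ s, (a i + (k - a j)) s + j = ∑ s, k s + i := by
    simp only [← ha, ← Finset.sum_add_distrib]
    refine Finset.sum_congr rfl fun s _ => ?_
    have hle : a j s ≤ k s := hak j s
    simp only [Pi.add_apply, Pi.sub_apply]
    omega
  refine ⟨a, fun j => k - a j, ?_⟩
  rw [Matrix.det_of_isUpperTriangular]
  · simp [hankelMatrix, add_tsub_cancel_of_le (hak _)]
  · intro i j hji
    have hlt : (j : ℕ) < i := hji
    have hij := hdeg i j
    exact hf (a i + (k - a j)) (by omega)

end Hankel

theorem norm_inner_smul_sub_sq {𝕜 E : Type*} [RCLike 𝕜] [SeminormedAddCommGroup E]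
    [InnerProductSpace 𝕜 E] {u : E} (hu : ‖u‖ = 1) (x : E) :
    ‖inner 𝕜 u x • u - x‖ ^ 2 = ‖x‖ ^ 2 - ‖inner 𝕜 x u‖ ^ 2 := by
  rw [norm_sub_sq (𝕜 := 𝕜), inner_smul_left, norm_smul, hu, RCLike.conj_mul,
    norm_inner_symm x u, ← RCLike.ofReal_pow, RCLike.ofReal_re]
  ring

section FockSpace

variable {m r : ℕ}

theorem sum_smul_fockState_apply (s : Finset (Fin m → ℕ)) (c : (Fin m → ℕ) → ℂ)
    (k : Fin m → ℕ) :
    (∑ l ∈ s, c l • fockState l : FockSpace m) k = if k ∈ s then c k else 0 := by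
  rw [lp.coeFn_sum, Finset.sum_apply]
  simp [fockState, Pi.single_apply]

/-- The functional `x ↦ √(k!) ⟨k|x⟩ = ⟨0| a ^ k |x⟩`, with `a` the annihilation operators. It is
the partial derivative of order `k` at the origin of the Bargmann function
`z ↦ ∑ l, ⟨l|x⟩ z ^ l / √(l!)`. -/
noncomputable def bargmannDeriv (k : Fin m → ℕ) : FockSpace m →L[ℂ] ℂ :=
  (∏ i, (Real.sqrt ((k i).factorial : ℝ) : ℂ)) • lp.evalCLM ℂ (fun _ : Fin m → ℕ => ℂ) 2 k

theorem bargmannDeriv_apply (k : Fin m → ℕ) (x : FockSpace m) :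
    bargmannDeriv k x = (∏ i, (Real.sqrt ((k i).factorial : ℝ) : ℂ)) * x k :=
  rfl

theorem ofReal_sqrt_factorial_ne_zero (k : ℕ) : (Real.sqrt (k.factorial : ℝ) : ℂ) ≠ 0 :=
  Complex.ofReal_ne_zero.2 (Real.sqrt_ne_zero'.2 (by positivity))

theorem bargmannDeriv_eq_zero_iff {k : Fin m → ℕ} {x : FockSpace m} :
    bargmannDeriv k x = 0 ↔ x k = 0 := by
  rw [bargmannDeriv_apply, mul_eq_zero_iff_left]
  exact Finset.prod_ne_zero_iff.2 fun i _ => ofReal_sqrt_factorial_ne_zero (k i)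

theorem bargmannDeriv_coherentState (k : Fin m → ℕ) (α : Fin m → ℂ) :
    bargmannDeriv k (coherentState α) = coherentState α 0 * ∏ i, α i ^ k i := by
  simp only [bargmannDeriv_apply, coherentState, ← Finset.prod_mul_distrib]
  refine Finset.prod_congr rfl fun i _ => ?_
  have := ofReal_sqrt_factorial_ne_zero (k i)
  simp only [coherentAmplitude, Pi.zero_apply, pow_zero, Nat.factorial_zero, Nat.cast_one,
    Real.sqrt_one, Complex.ofReal_one, div_one, mul_one]
  field_simp

/-- The vectors that are linear combinations of at most `r` coherent states; unlike the
approximating states of `IsApproxByCoherent`, they need not be normalized. -/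
def coherentSuperpositions (m r : ℕ) : Set (FockSpace m) :=
  {x | ∃ (c : Fin r → ℂ) (α : Fin r → Fin m → ℂ), x = ∑ j, c j • coherentState (α j)}

theorem smul_mem_coherentSuperpositions {x : FockSpace m} (z : ℂ)
    (hx : x ∈ coherentSuperpositions m r) : z • x ∈ coherentSuperpositions m r := by
  obtain ⟨c, α, rfl⟩ := hx
  exact ⟨fun j => z * c j, α, by simp only [Finset.smul_sum, smul_smul]⟩

theorem det_hankelMatrix_bargmannDeriv_eq_zero {ι : Type*} [Fintype ι] [DecidableEq ι]
    (hr : r < Fintype.card ι) (a b : ι → Fin m → ℕ) {x : FockSpace m}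
    (hx : x ∈ closure (coherentSuperpositions m r)) :
    (hankelMatrix (fun k => bargmannDeriv k x) a b).det = 0 := by
  have hcont : Continuous fun y : FockSpace m =>
      (hankelMatrix (fun k => bargmannDeriv k y) a b).det :=
    (continuous_matrix fun i j => (bargmannDeriv (a i + b j)).continuous).matrix_det
  refine closure_minimal ?_ (isClosed_eq hcont continuous_const) hx
  rintro _ ⟨c, α, rfl⟩
  have hmonomial (j : Fin r) (k l : Fin m → ℕ) :
      ∏ i, α j i ^ (k + l) i = (∏ i, α j i ^ k i) * ∏ i, α j i ^ l i := by
    simp only [Pi.add_apply, pow_add, Finset.prod_mul_distrib]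
  simpa only [Set.mem_ofPred_eq, map_sum, map_smul, smul_eq_mul, bargmannDeriv_coherentState,
    mul_assoc] using
    det_hankelMatrix_sum_eq_zero (χ := fun j k => ∏ i, α j i ^ k i) (by simpa using hr)
      (fun j => c j * coherentState (α j) 0) hmonomial a b

theorem sum_lt_of_mem_closure_coherentSuperpositions {x : FockSpace m} {k : Fin m → ℕ}
    (hk : x k ≠ 0) (hdeg : ∀ l : Fin m → ℕ, ∑ i, k i < ∑ i, l i → x l = 0)
    (hx : x ∈ closure (coherentSuperpositions m r)) : ∑ i, k i < r := by
  by_contra! hr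
  obtain ⟨a, b, hdet⟩ := exists_det_hankelMatrix_eq_pow (f := fun l => bargmannDeriv l x)
    fun l hl => bargmannDeriv_eq_zero_iff.2 (hdeg l hl)
  rw [det_hankelMatrix_bargmannDeriv_eq_zero (by simpa using hr.trans_lt (Nat.lt_succ_self _))
    a b hx] at hdet
  exact pow_ne_zero _ (bargmannDeriv_eq_zero_iff.not.2 hk) hdet.symm

theorem IsApproxByCoherent.mem_closure_coherentSuperpositions {ψ : FockSpace m}
    (hψ : ‖ψ‖ = 1) (h : IsApproxByCoherent ψ r) : ψ ∈ closure (coherentSuperpositions m r) := by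
  refine Metric.mem_closure_iff.2 fun δ hδ => ?_
  obtain ⟨c, α, φ, hφ, hφ_norm, hfid⟩ := h (δ ^ 2 / 2) (by positivity)
  -- Fidelity ignores the global phase, so `φ` itself need not be close to `ψ`.
  refine ⟨inner ℂ φ ψ • φ, smul_mem_coherentSuperpositions _ ⟨c, α, hφ⟩, ?_⟩
  rw [dist_comm, dist_eq_norm]
  refine lt_of_pow_lt_pow_left₀ 2 hδ.le ?_
  calc ‖inner ℂ φ ψ • φ - ψ‖ ^ 2
      = 1 - fidelity ψ φ := by rw [norm_inner_smul_sub_sq hφ_norm, hψ, one_pow, fidelity]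
    _ ≤ δ ^ 2 / 2 := by linarith
    _ < δ ^ 2 := half_lt_self (by positivity)

end FockSpace

theorem theorem3 (m n : ℕ) (c : (Fin m → ℕ) → ℂ) (ψ : FockSpace m)
    (hψ : ψ = ∑ k ∈ occupationsLE m n, c k • fockState k)
    (hnorm : ‖ψ‖ = 1)
    (hc : ∃ k : Fin m → ℕ, ∑ i, k i = n ∧ c k ≠ 0) :
    (n : ℕ∞) + 1 ≤ approxCoherentStateRank ψ := by
  obtain ⟨k, rfl, hck⟩ := hc
  have happly (l : Fin m → ℕ) : ψ l = if ∑ i, l i ≤ ∑ i, k i then c l else 0 := by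
    simp only [hψ, sum_smul_fockState_apply, mem_occupationsLE]
  have hk : ψ k ≠ 0 := by rwa [happly, if_pos le_rfl]
  have hdeg (l : Fin m → ℕ) (hl : ∑ i, k i < ∑ i, l i) : ψ l = 0 := by
    rw [happly, if_neg hl.not_ge]
  refine le_iInf₂ fun r hr => ?_
  have hlt : ∑ i, k i < r := sum_lt_of_mem_closure_coherentSuperpositions hk hdeg
    (hr.mem_closure_coherentSuperpositions hnorm)
  exact_mod_cast hlt
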